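/- Let $G$ be a locally compact Polish (LCP) group with Haar measure $m_G$, and let $p$ be a Borel probability on $G$ which is globally supported, i.e. the closed subgroup generated by $\operatorname{supp} p$ is $G$ (the random walk on $G$ with jump probability $p$ is adapted). A non-singular $G$-action on a standard probability space $(Y,\nu)$ is a measurable homomorphism $g\mapsto S_g$ from $G$ to the Polish group $\mathrm{Aut}(Y,\nu)$ of invertible non-singular transformations of $(Y,\nu)$, taken modulo null sets; it is probability preserving if every $S_g$ preserves $\nu$, and ergodic if every measurable $A\subseteq Y$ with $\nu(S_g^{-1}A\,\triangle\, A)=0$ for all $g\in G$ satisfies $\nu(A)=0$ or $\nu(Y\setminus A)=0$. Let $X=G^{\mathbb N}$ (with coordinates $x_1,x_2,\dots$), let $\mu_p=p^{\mathbb N}$, let $T:X\to X$ be the one-sided shift $(Tx)_n=x_{n+1}$ and let $f(x)=x_1$. Put $T_f(x,g)=(Tx,f(x)g)$ and $Q_t(x,g)=(x,gt^{-1})$ on $X\times G$. The Poisson boundary $\mathfrak p(T,f)$ of the random walk is a non-singular $G$-action $\mathfrak p$ on a standard probability space $(\Omega,P)$ for which there are a probability $\mathbb P\sim\mu_p\times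 m_G$ on $X\times G$ and a measurable map $\pi:X\times G\to\Omega$ such that $\mathbb P\circ\pi^{-1}=P$, $\pi\circ T_f=\pi$ a.e., the $\sigma$-algebra $\pi^{-1}\mathcal B(\Omega)$ equals $\{B\in\mathcal B(X\times G): T_f^{-1}B=B\}$ modulo $\mathbb P$-null sets, and $\pi\circ Q_t=\mathfrak p_t\circ\pi$ a.e. for every $t\in G$. **Proposition 4.4.** The Poisson boundary $\mathfrak p(T,f)$ exists, and it (that is, every $(\Omega,P,\mathfrak p)$ as above) is weakly mixing: for every ergodic probability preserving $G$-action $S$ on a standard probability space $(Y,\nu)$, the product action $g\mapsto \mathfrak p_g\times S_g$ on $(\Omega\times Y,P\times\nu)$ is ergodic. -/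

import Mathlib

open MeasureTheory Set Filter

universe u v w

namespace PoissonBdry

/-- A non-singular action of `G` on `(Y, ν)`, i.e. a measurable homomorphism from `G` to the Polish
group `Aut(Y, ν)` of invertible non-singular transformations modulo `ν`-null sets. It is given by a
choice of representatives `S g : Y → Y`, so that the homomorphism identities hold `ν`-a.e. for each
fixed pair of group elements; in particular `S g⁻¹` is an a.e. inverse of `S g`, and both are
non-singular. The Borel structure of `Aut(Y, ν)` is generated by the maps
`R ↦ ν (R⁻¹ A ∩ B)` for `A`, `B` measurable, whence the last field. -/
structure IsNonsingularAction {G : Type u} [Group G] [MeasurableSpace G]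
    {Y : Type v} [MeasurableSpace Y] (ν : Measure Y) (S : G → Y → Y) : Prop where
  quasiMeasurePreserving : ∀ g, Measure.QuasiMeasurePreserving (S g) ν ν
  one_ae : S 1 =ᵐ[ν] id
  mul_ae : ∀ g h, S (g * h) =ᵐ[ν] S g ∘ S h
  measurable_action : ∀ A B : Set Y, MeasurableSet A → MeasurableSet B →
    Measurable fun g => ν (S g ⁻¹' A ∩ B)

/-- A probability preserving action of `G`. -/
structure IsProbabilityPreservingAction {G : Type u} [Group G] [MeasurableSpace G]
    {Y : Type v} [MeasurableSpace Y] (ν : Measure Y) (S : G → Y → Y) : Prop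
    extends IsNonsingularAction ν S where
  isProbabilityMeasure : IsProbabilityMeasure ν
  measurePreserving : ∀ g, MeasurePreserving (S g) ν ν

/-- Ergodicity of an action: a measurable set which is, for every `g`, invariant modulo null sets
under `S g` is null or conull. -/
def IsErgodicAction {G : Type u} {Y : Type v} [MeasurableSpace Y] (ν : Measure Y)
    (S : G → Y → Y) : Prop :=
  ∀ A : Set Y, MeasurableSet A → (∀ g, S g ⁻¹' A =ᵐ[ν] A) → ν A = 0 ∨ ν Aᶜ = 0

/-- The product (diagonal) action `V × S`. -/
def prodAction {G : Type u} {Ω : Type v} {Y : Type w} (V : G → Ω → Ω) (S : G → Y → Y) :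
    G → Ω × Y → Ω × Y :=
  fun g => Prod.map (V g) (S g)

/-- Weak mixing of an action `V` of `G` on `(Ω, P)`: the product `V × S` is ergodic for every
ergodic probability preserving action `S` of `G` on a standard probability space. -/
def IsWeaklyMixing {G : Type u} [Group G] [MeasurableSpace G] {Ω : Type v} [MeasurableSpace Ω]
    (P : Measure Ω) (V : G → Ω → Ω) : Prop :=
  ∀ (Y : Type w) [MeasurableSpace Y] [StandardBorelSpace Y] (ν : Measure Y) (S : G → Y → Y),
    IsProbabilityPreservingAction ν S → IsErgodicAction ν S →
      IsErgodicAction (P.prod ν) (prodAction V S)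

/-- The left skew product `T_f (x, g) = (T x, f x * g)`. -/
def skewProduct {X : Type v} {G : Type u} [Mul G] (T : X → X) (f : X → G) : X × G → X × G :=
  fun z => (T z.1, f z.1 * z.2)

/-- The right translation action `Q_t (x, g) = (x, g * t⁻¹)`, which commutes with `T_f`. -/
def rightTranslation {X : Type v} {G : Type u} [Group G] (t : G) : X × G → X × G :=
  fun z => (z.1, z.2 * t⁻¹)

/-- `V`, acting on the standard probability space `(Ω, P)`, is (a realization of) the invariant, or
Poisson, `G`-action `𝔭(T, f)` associated to the endomorphism `T` of `(X, m)` and to `f : X → G`.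
Here `ℙ` is a probability equivalent to `m × m_G`, the map `π` exhibits `(Ω, P)` as the factor of
`(X × G, ℙ)` given by the `σ`-algebra `MeasurableSpace.invariants (skewProduct T f)` of the
measurable sets `B` with `T_f⁻¹ B = B` (as usual for factors, the two `σ`-algebras are equal modulo
null sets), and `π` intertwines `Q` with `V`. -/
def IsPoissonAction {X : Type w} [MeasurableSpace X] {G : Type u} [Group G] [TopologicalSpace G]
    [IsTopologicalGroup G] [LocallyCompactSpace G] [MeasurableSpace G] [BorelSpace G]
    (m : Measure X) (T : X → X) (f : X → G)
    {Ω : Type v} [MeasurableSpace Ω] (P : Measure Ω) (V : G → Ω → Ω) : Prop :=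
  IsNonsingularAction P V ∧
  ∃ (ℙ : Measure (X × G)) (π : X × G → Ω),
    IsProbabilityMeasure ℙ ∧
    ℙ ≪ m.prod Measure.haar ∧ m.prod Measure.haar ≪ ℙ ∧
    MeasurePreserving π ℙ P ∧
    π ∘ skewProduct T f =ᵐ[ℙ] π ∧
    (∀ A : Set Ω, MeasurableSet A →
      ∃ B, MeasurableSet[MeasurableSpace.invariants (skewProduct T f)] B ∧ π ⁻¹' A =ᵐ[ℙ] B) ∧
    (∀ B : Set (X × G), MeasurableSet[MeasurableSpace.invariants (skewProduct T f)] B →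
      ∃ A : Set Ω, MeasurableSet A ∧ π ⁻¹' A =ᵐ[ℙ] B) ∧
    ∀ t : G, π ∘ rightTranslation t =ᵐ[ℙ] V t ∘ π

/-- The one-sided shift on `G^ℕ`. -/
def shift {G : Type u} (x : ℕ → G) : ℕ → G := fun n => x (n + 1)

/-- The first jump. -/
def firstJump {G : Type u} (x : ℕ → G) : G := x 0

/-- `V`, acting on `(Ω, P)`, is (a realization of) the Poisson boundary of the random walk on `G`
with jump probability `p`: the Poisson action associated to the jump process
`(G^ℕ, p^ℕ, shift, first jump)`. -/
def IsPoissonBoundary {G : Type u} [Group G] [TopologicalSpace G]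
    [IsTopologicalGroup G] [LocallyCompactSpace G] [MeasurableSpace G] [BorelSpace G]
    (p : Measure G) [IsProbabilityMeasure p]
    {Ω : Type v} [MeasurableSpace Ω] (P : Measure Ω) (V : G → Ω → Ω) : Prop :=
  IsPoissonAction (Measure.infinitePi fun _ : ℕ => p) shift firstJump P V

/-- The random walk with jump probability `p` is adapted: `p` is globally supported, i.e. the
closed subgroup generated by the topological support of `p` is all of `G`. -/
def IsAdaptedWalk {G : Type u} [Group G] [TopologicalSpace G] [IsTopologicalGroup G]
    [MeasurableSpace G] (p : Measure G) : Prop :=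
  (Subgroup.closure p.support).topologicalClosure = ⊤

end PoissonBdry

namespace PoissonBdry

open scoped Topology symmDiff ENNReal

/-! Existence. Modulo null sets the `T_f`-invariant sets contain a dense sequence, and the
indicators of this sequence map `X × G` to the Cantor space. Each `Q_t` commutes with `T_f`, so it
permutes the invariant sets; this determines the action on the image, for the image measure.

Weak mixing. Let `A ⊆ Ω × Y` be invariant. Its lift `A'` to `X × G × Y` is invariant under `T_f ×
id` and `Q_t × S_t`. Put `B = {(x, g, y) | (x, g, S_{g⁻¹} y) ∈ A'}`. In these coordinates `Q_t ×
S_t` becomes `Q_t × id`, and `T_f × id` becomes `(x, g, y) ↦ (Tx, x₁ g, S_{x₁} y)`. By the first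
invariance `B` depends only on `(x, y)`, through a set `C` (`exists_ae_mem_iff_snd_mem`). By the
second, `C` is invariant under the random transformation `R (x, y) = (Tx, S_{x₁} y)`. Since `R` is
ergodic, `C` is trivial, and so is `A`.

Ergodicity of `R` (`random_ergodic`). The slice measure `k y = μ_p (C_y)` is the `p`-average of the
functions `k ∘ S_g`, which all have the same `L²` norm as `k`. Hence `k ∘ S_g = k` for `p`-almost
every `g`. Stabilizers of sets are closed subgroups, so adaptedness and ergodicity of `S` make `k` a
constant `c`. Conditioning on successive coordinates gives `μ_p (C_y ∩ E) = c μ_p E` for all `E`,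
which forces the indicator of `C` to be almost everywhere constant. -/

/-- A family of measurable sets contains a sequence which is dense in it for the measure of the
symmetric difference. -/
theorem exists_seq_dense_subfamily {α : Type*} [MeasurableSpace α] (μ : Measure α)
    [IsFiniteMeasure μ] [IsSeparable μ] {𝓑 : Set (Set α)} (hm : ∀ B ∈ 𝓑, MeasurableSet B)
    (hne : 𝓑.Nonempty) :
    ∃ s : ℕ → Set α, (∀ n, s n ∈ 𝓑) ∧
      ∀ B ∈ 𝓑, ∀ ε : ℝ≥0∞, ε ≠ 0 → ∃ n, μ (B ∆ s n) < ε := by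
  obtain ⟨𝒜, h𝒜c, h𝒜⟩ := exists_countable_measureDense μ
  have : TopologicalSpace.SeparableSpace (MeasuredSets μ) := by
    refine ⟨{t | (t : Set α) ∈ 𝒜}, h𝒜c.preimage SetLike.coe_injective, ?_⟩
    intro t
    rw [Metric.mem_closure_iff]
    intro ε hε
    obtain ⟨a, ha, hta⟩ := h𝒜.approx t t.2 (measure_ne_top _ _) ε hε
    refine ⟨⟨a, h𝒜.measurable a ha⟩, ha, ?_⟩
    exact (ENNReal.lt_ofReal_iff_toReal_lt (measure_ne_top _ _)).1 hta
  -- Second countability, unlike separability in general, passes to the subspace `K`.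
  have : SecondCountableTopology (MeasuredSets μ) := UniformSpace.secondCountable_of_separable _
  let K : Set (MeasuredSets μ) := {t | (t : Set α) ∈ 𝓑}
  obtain ⟨B₀, hB₀⟩ := hne
  have : Nonempty K := ⟨⟨⟨B₀, hm _ hB₀⟩, hB₀⟩⟩
  refine ⟨fun n => ((TopologicalSpace.denseSeq K n : K) : MeasuredSets μ),
    fun n => (TopologicalSpace.denseSeq K n).2, fun B hB ε hε => ?_⟩
  obtain ⟨n, hn⟩ := (TopologicalSpace.denseRange_denseSeq K).exists_mem_open
    (Metric.isOpen_eball (x := (⟨⟨B, hm B hB⟩, hB⟩ : K)) (ε := ε))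
    ⟨_, Metric.mem_eball_self (pos_iff_ne_zero.2 hε)⟩
  exact ⟨n, (edist_comm _ _).trans_lt hn⟩

/-! ### Continuity of the action on sets, and stabilizers -/

section Stabilizer

variable {G : Type u} [Group G] [MeasurableSpace G] {Y : Type v} [MeasurableSpace Y]
  {ν : Measure Y} {S : G → Y → Y}

theorem IsProbabilityPreservingAction.measure_symmDiff_preimage
    (hS : IsProbabilityPreservingAction ν S) {D : Set Y} (hD : MeasurableSet D) (a b : G) :
    ν ((S a ⁻¹' D) ∆ (S b ⁻¹' D)) = ν ((S (a * b⁻¹) ⁻¹' D) ∆ D) := by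
  have h : S a ⁻¹' D =ᵐ[ν] S b ⁻¹' (S (a * b⁻¹) ⁻¹' D) := by
    have := hS.mul_ae (a * b⁻¹) b
    rw [inv_mul_cancel_right] at this
    filter_upwards [this] with y hy
    simp only [eq_iff_iff]
    change S a y ∈ D ↔ S (a * b⁻¹) (S b y) ∈ D
    rw [hy]; rfl
  refine (measure_congr (ae_eq_set_symmDiff h (EventuallyEq.refl _ _))).trans ?_
  change ν (S b ⁻¹' ((S (a * b⁻¹) ⁻¹' D) ∆ D)) = _
  refine (hS.measurePreserving b).measure_preimage ?_
  exact ((hS.measurePreserving _).measurable hD |>.symmDiff hD).nullMeasurableSet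

theorem IsProbabilityPreservingAction.measure_symmDiff_one
    (hS : IsProbabilityPreservingAction ν S) {D : Set Y} (hD : MeasurableSet D) (a : G) :
    ν ((S (a⁻¹) ⁻¹' D) ∆ D) = ν ((S a ⁻¹' D) ∆ D) := by
  have h := hS.measure_symmDiff_preimage hD a 1
  have h' := hS.measure_symmDiff_preimage hD 1 a
  rw [one_mul, symmDiff_comm] at h'
  rw [inv_one, mul_one] at h
  rw [← h', h]

theorem IsProbabilityPreservingAction.measure_symmDiff_mul_inv_le
    (hS : IsProbabilityPreservingAction ν S) {D : Set Y} (hD : MeasurableSet D) (a b : G) :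
    ν ((S (a * b⁻¹) ⁻¹' D) ∆ D) ≤ ν ((S a ⁻¹' D) ∆ D) + ν ((S b ⁻¹' D) ∆ D) := by
  rw [← hS.measure_symmDiff_preimage hD a b]
  refine (measure_symmDiff_le _ D _).trans ?_
  rw [symmDiff_comm D]

theorem IsNonsingularAction.measurable_measure_symmDiff
    (hS : IsNonsingularAction ν S) {D : Set Y} (hD : MeasurableSet D) :
    Measurable fun g => ν ((S g ⁻¹' D) ∆ D) := by
  have h : (fun g => ν ((S g ⁻¹' D) ∆ D)) =
      fun g => ν (S g ⁻¹' D ∩ Dᶜ) + ν (S g ⁻¹' Dᶜ ∩ D) := by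
    funext g
    have hm := (hS.quasiMeasurePreserving g).measurable hD
    rw [measure_symmDiff_eq hm.nullMeasurableSet hD.nullMeasurableSet, sdiff_eq,
      preimage_compl, inter_comm _ D, sdiff_eq]
  rw [h]
  exact (hS.measurable_action _ _ hD hD.compl).add (hS.measurable_action _ _ hD.compl hD)

variable [TopologicalSpace G] [IsTopologicalGroup G] [LocallyCompactSpace G] [PolishSpace G]
  [BorelSpace G] [MeasurableSpace.CountablyGenerated Y]

/-- Automatic continuity, by a Steinhaus–Weil argument. The orbit of `D` is separable, so countably
many right translates of `E` cover `G`. Thus `E` has positive Haar measure and `E / E` is a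
neighbourhood of `1`. -/
theorem IsProbabilityPreservingAction.eventually_measure_symmDiff_lt
    (hS : IsProbabilityPreservingAction ν S) {D : Set Y} (hD : MeasurableSet D)
    {ε : ℝ≥0∞} (hε : ε ≠ 0) : ∀ᶠ g in 𝓝 (1 : G), ν ((S g ⁻¹' D) ∆ D) < ε := by
  have := hS.isProbabilityMeasure
  set E : Set G := {g | ν ((S g ⁻¹' D) ∆ D) < ε / 2} with hE
  have hEm : MeasurableSet E :=
    hS.toIsNonsingularAction.measurable_measure_symmDiff hD measurableSet_Iio
  have hpos : 0 < (Measure.haar : Measure G) E := by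
    rw [pos_iff_ne_zero]
    intro h0
    obtain ⟨s, hs, hd⟩ := exists_seq_dense_subfamily ν (𝓑 := range fun g => S g ⁻¹' D)
      (by rintro _ ⟨g, rfl⟩; exact (hS.measurePreserving g).measurable hD) ⟨_, 1, rfl⟩
    choose g hg using hs
    have hcov : (univ : Set G) ⊆ ⋃ n, (fun h => h * (g n)⁻¹) ⁻¹' E := by
      intro h _
      obtain ⟨n, hn⟩ := hd _ ⟨h, rfl⟩ (ε / 2) (by simpa using hε)
      refine mem_iUnion.2 ⟨n, ?_⟩
      rw [← hg n] at hn
      change ν _ < _ at hn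
      rw [hS.measure_symmDiff_preimage hD] at hn
      exact hn
    have : (Measure.haar : Measure G) univ = 0 := by
      refine measure_mono_null hcov (measure_iUnion_null fun n => ?_)
      exact (measure_mul_right_null _ _).2 h0
    exact NeZero.ne _ (Measure.measure_univ_eq_zero.1 this)
  have hnhds := Measure.div_mem_nhds_one_of_haar_pos (Measure.haar : Measure G) E hEm hpos
  filter_upwards [hnhds] with g hg
  obtain ⟨a, ha, b, hb, rfl⟩ := mem_div.1 hg
  rw [div_eq_mul_inv]
  calc _ ≤ _ := hS.measure_symmDiff_mul_inv_le hD a b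
    _ < ε / 2 + ε / 2 := ENNReal.add_lt_add ha hb
    _ = ε := ENNReal.add_halves ε

/-- If a measurable set is invariant under almost every jump of an adapted random walk, then it is
invariant under the whole group. -/
theorem IsProbabilityPreservingAction.preimage_ae_eq_of_isAdaptedWalk
    (hS : IsProbabilityPreservingAction ν S) {p : Measure G} (hp : IsAdaptedWalk p)
    {D : Set Y} (hD : MeasurableSet D) (h : ∀ᵐ g ∂p, S g ⁻¹' D =ᵐ[ν] D) (g : G) :
    S g ⁻¹' D =ᵐ[ν] D := by
  -- The stabilizer of `D` modulo null sets. It is closed by continuity at `1` and has full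
  -- `p`-measure, so it contains the support of `p`.
  let H : Subgroup G :=
    { carrier := {g | ν ((S g ⁻¹' D) ∆ D) = 0}
      one_mem' := by
        refine measure_symmDiff_eq_zero_iff.2 ?_
        filter_upwards [hS.one_ae] with y hy
        simp only [eq_iff_iff]
        change S 1 y ∈ D ↔ y ∈ D
        rw [hy]; rfl
      inv_mem' := by
        intro a ha
        exact (hS.measure_symmDiff_one hD a).trans ha
      mul_mem' := by
        intro a b ha hb
        have := hS.measure_symmDiff_mul_inv_le hD a b⁻¹
        rw [inv_inv, hS.measure_symmDiff_one hD b] at this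
        change ν _ = 0 at ha hb
        rw [ha, hb, add_zero] at this
        exact le_antisymm this zero_le }
  have hHc : IsClosed (H : Set G) := by
    refine isClosed_of_closure_subset fun x hx => ?_
    change ν _ = 0
    refine le_antisymm (le_of_forall_gt fun ε hε => ?_) zero_le
    have hev := hS.eventually_measure_symmDiff_lt hD hε.ne'
    have htend : Tendsto (fun y : G => x * y⁻¹) (𝓝 x) (𝓝 1) := by
      have : Continuous fun y : G => x * y⁻¹ := by fun_prop
      simpa using this.tendsto x
    obtain ⟨y, hy, hyH⟩ := mem_closure_iff_nhds.1 hx _ (htend hev)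
    have hle := hS.measure_symmDiff_mul_inv_le hD (x * y⁻¹) y⁻¹
    rw [inv_inv, inv_mul_cancel_right, hS.measure_symmDiff_one hD y,
      show ν ((S y ⁻¹' D) ∆ D) = 0 from hyH, add_zero] at hle
    exact hle.trans_lt hy
  have hsupp : p.support ⊆ H := by
    refine Measure.support_subset_of_isClosed hHc ?_
    filter_upwards [h] with g hg
    exact measure_symmDiff_eq_zero_iff.2 hg
  have htop : H = ⊤ := by
    rw [eq_top_iff, ← show (Subgroup.closure p.support).topologicalClosure = ⊤ from hp]
    exact Subgroup.topologicalClosure_minimal _ ((Subgroup.closure_le _).2 hsupp) hHc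
  have : g ∈ H := htop ▸ Subgroup.mem_top g
  exact measure_symmDiff_eq_zero_iff.1 this

/-- A measurable function which is invariant under almost every jump of an adapted random walk is
almost everywhere constant, if the action is ergodic. -/
theorem IsProbabilityPreservingAction.exists_ae_eq_const
    (hS : IsProbabilityPreservingAction ν S) (hE : IsErgodicAction ν S) {p : Measure G}
    (hp : IsAdaptedWalk p) {k : Y → ℝ} (hk : Measurable k)
    (h : ∀ᵐ g ∂p, k ∘ S g =ᵐ[ν] k) : ∃ c, k =ᵐ[ν] Function.const Y c := by
  refine exists_eventuallyEq_const_of_forall_separating MeasurableSet fun U hU => ?_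
  have hinv := hS.preimage_ae_eq_of_isAdaptedWalk hp (hk hU) (by
    filter_upwards [h] with g hg
    filter_upwards [hg] with y hy
    simp only [eq_iff_iff]
    change k (S g y) ∈ U ↔ k y ∈ U
    rw [← hy]; rfl)
  rcases hE _ (hk hU) hinv with h0 | h0
  · exact Or.inr (measure_eq_zero_iff_ae_notMem.1 h0)
  · exact Or.inl (mem_ae_iff.2 h0)

end Stabilizer

/-! ### Existence of the Poisson action -/

section Existence

open scoped Classical in
/-- The map to the Cantor space given by the indicators of a sequence of sets. -/
noncomputable def itinerary {α : Type*} (s : ℕ → Set α) (x : α) : ℕ → Bool :=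
  fun n => decide (x ∈ s n)

theorem itinerary_eq_true_iff {α : Type*} {s : ℕ → Set α} {x : α} {n : ℕ} :
    itinerary s x n = true ↔ x ∈ s n := by
  simp [itinerary]

theorem measurable_itinerary {α : Type*} [MeasurableSpace α] {s : ℕ → Set α}
    (hs : ∀ n, MeasurableSet (s n)) : Measurable (itinerary s) := by
  refine measurable_pi_iff.2 fun n => measurable_to_bool ?_
  convert! hs n
  ext x
  simp [itinerary]

/-- A set which is approximated in measure by a sequence of sets is, modulo null sets, measurable
with respect to the itinerary of that sequence. -/
theorem exists_preimage_itinerary_ae_eq {α : Type*} [MeasurableSpace α] {μ : Measure α}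
    {s : ℕ → Set α} {B : Set α} (h : ∀ ε : ℝ≥0∞, ε ≠ 0 → ∃ n, μ (B ∆ s n) < ε) :
    ∃ A : Set (ℕ → Bool), MeasurableSet A ∧ itinerary s ⁻¹' A =ᵐ[μ] B := by
  -- The errors `2⁻ᵏ` are summable, so by Borel–Cantelli almost every point eventually lies in `s (n
  -- k)` exactly when it lies in `B`.
  choose n hn using fun k : ℕ => h ((2⁻¹ : ℝ≥0∞) ^ k) (by simp)
  refine ⟨limsup (fun k => {ω : ℕ → Bool | ω (n k) = true}) atTop,
    MeasurableSet.measurableSet_limsup fun k =>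
      measurableSet_eq_fun (measurable_pi_apply (n k)) measurable_const, ?_⟩
  have h0 : μ (limsup (fun k => B ∆ s (n k)) atTop) = 0 := by
    refine measure_limsup_atTop_eq_zero (ne_top_of_le_ne_top ?_
      (ENNReal.tsum_le_tsum fun k => (hn k).le))
    rw [ENNReal.tsum_geometric]
    simp [ENNReal.one_sub_inv_two]
  filter_upwards [measure_eq_zero_iff_ae_notMem.1 h0] with x hx
  rw [mem_limsup_iff_frequently_mem, not_frequently] at hx
  simp only [eq_iff_iff]
  change itinerary s x ∈ limsup _ _ ↔ x ∈ B
  rw [mem_limsup_iff_frequently_mem]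
  simp only [mem_ofPred_eq, itinerary_eq_true_iff]
  have hiff : ∀ᶠ k in atTop, (x ∈ s (n k) ↔ x ∈ B) := by
    filter_upwards [hx] with k hk
    rw [mem_symmDiff] at hk
    tauto
  rw [frequently_congr hiff, frequently_const]

variable {X : Type w} {G : Type u} [Group G]

theorem skewProduct_rightTranslation (T : X → X) (f : X → G) (t : G) (z : X × G) :
    skewProduct T f (rightTranslation t z) = rightTranslation t (skewProduct T f z) := by
  simp [skewProduct, rightTranslation, mul_assoc]

variable [MeasurableSpace X] [TopologicalSpace G] [IsTopologicalGroup G] [MeasurableSpace G]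
  [BorelSpace G]

theorem measurable_rightTranslation (t : G) :
    Measurable (rightTranslation t : X × G → X × G) := by
  unfold rightTranslation
  fun_prop

variable [LocallyCompactSpace G] [PolishSpace G]

theorem quasiMeasurePreserving_rightTranslation (m : Measure X) [SFinite m] (t : G) :
    Measure.QuasiMeasurePreserving (rightTranslation t) (m.prod (Measure.haar : Measure G))
      (m.prod Measure.haar) :=
  QuasiMeasurePreserving.prodMap (.id m)
    (quasiMeasurePreserving_mul_right (Measure.haar : Measure G) t⁻¹)

/-- Existence of the Poisson action. -/
theorem exists_isPoissonAction [MeasurableSpace.CountablyGenerated X] (m : Measure X) [SFinite m]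
    [NeZero m] (T : X → X) (f : X → G) :
    ∃ (P : Measure (ℕ → Bool)) (V : G → (ℕ → Bool) → (ℕ → Bool)), IsPoissonAction m T f P V := by
  have hne : NeZero (m.prod (Measure.haar : Measure G)) := ⟨by
    rw [Ne, ← Measure.measure_univ_eq_zero, ← univ_prod_univ, Measure.prod_prod]
    simp [NeZero.ne m, NeZero.ne (Measure.haar : Measure G)]⟩
  let ℙ : Measure (X × G) := (m.prod (Measure.haar : Measure G)).toFinite
  have hℙ₁ : ℙ ≪ m.prod Measure.haar := toFinite_absolutelyContinuous _
  have hℙ₂ : m.prod Measure.haar ≪ ℙ := absolutelyContinuous_toFinite _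
  have hprob : IsProbabilityMeasure ℙ := inferInstanceAs (IsProbabilityMeasure (Measure.toFinite _))
  have hQ (t : G) : Measure.QuasiMeasurePreserving (rightTranslation t) ℙ ℙ :=
    (quasiMeasurePreserving_rightTranslation m t).mono hℙ₁ hℙ₂
  obtain ⟨s, hs, hd⟩ := exists_seq_dense_subfamily ℙ
    (𝓑 := {B | MeasurableSet[MeasurableSpace.invariants (skewProduct T f)] B})
    (fun B hB => (MeasurableSpace.measurableSet_invariants.1 hB).1) 
      ⟨∅, @MeasurableSet.empty _ (MeasurableSpace.invariants (skewProduct T f))⟩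
  have hB (B : Set (X × G)) (hB : MeasurableSet[MeasurableSpace.invariants (skewProduct T f)] B) :
      ∃ A : Set (ℕ → Bool), MeasurableSet A ∧ itinerary s ⁻¹' A =ᵐ[ℙ] B :=
    exists_preimage_itinerary_ae_eq (hd B hB)
  have hQs (t : G) (n : ℕ) : MeasurableSet[MeasurableSpace.invariants (skewProduct T f)]
      (rightTranslation t ⁻¹' s n) := by
    have := MeasurableSpace.measurableSet_invariants.1 (hs n)
    refine MeasurableSpace.measurableSet_invariants.2
      ⟨measurable_rightTranslation t this.1, ?_⟩
    conv_rhs => rw [← this.2]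
    ext z
    simp only [mem_preimage, skewProduct_rightTranslation]
  choose A hAm hA using fun t n => hB _ (hQs t n)
  have hπinv : Measurable[MeasurableSpace.invariants (skewProduct T f)] (itinerary s) :=
    @measurable_itinerary _ (MeasurableSpace.invariants (skewProduct T f)) _ hs
  have hπ : Measurable (itinerary s) := hπinv.mono (MeasurableSpace.invariants_le _) le_rfl
  let P : Measure (ℕ → Bool) := ℙ.map (itinerary s)
  have hπP : MeasurePreserving (itinerary s) ℙ P := ⟨hπ, rfl⟩
  -- Equivariance dictates the choice: `A t n` pulls back to `rightTranslation t ⁻¹' s n` modulo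
  -- null sets.
  let V : G → (ℕ → Bool) → (ℕ → Bool) := fun t => itinerary (A t)
  have hVm (t : G) : Measurable (V t) := measurable_itinerary (hAm t)
  have hV (t : G) : itinerary s ∘ rightTranslation t =ᵐ[ℙ] V t ∘ itinerary s := by
    filter_upwards [ae_all_iff.2 (hA t)] with z hz
    funext n
    rw [Bool.eq_iff_iff]
    simp only [Function.comp_apply, V, itinerary_eq_true_iff]
    exact (iff_of_eq (hz n)).symm
  refine ⟨P, V, ⟨fun t => ⟨hVm t, ?_⟩, ?_, fun t t' => ?_, fun A' B' hA' hB' => ?_⟩,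
    ℙ, itinerary s, hprob, hℙ₁, hℙ₂, hπP, ?_, ?_, hB, hV⟩
  · rw [Measure.map_map (hVm t) hπ, ← Measure.map_congr (hV t),
      ← Measure.map_map hπ (measurable_rightTranslation t)]
    exact (hQ t).absolutelyContinuous.map hπ
  · refine (ae_map_iff hπ.aemeasurable (measurableSet_eq_fun (hVm 1) measurable_id)).2 ?_
    filter_upwards [hV 1] with z hz
    refine Eq.trans hz.symm ?_
    simp [rightTranslation]
  · refine (ae_map_iff hπ.aemeasurable
      (measurableSet_eq_fun (hVm _) ((hVm t).comp (hVm t')))).2 ?_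
    filter_upwards [hV (t * t'), (hQ t').ae (hV t), hV t'] with z h₁ h₂ h₃
    simp only [Function.comp_apply] at h₁ h₂ h₃ ⊢
    rw [← h₁, ← h₃, ← h₂]
    simp [rightTranslation, mul_assoc]
  -- Joint measurability of `V` is not available; replacing `V g ∘ π` by `π ∘ Q_g`, which is jointly
  -- measurable, reduces the claim to Fubini.
  · have hset : (fun g => P (V g ⁻¹' A' ∩ B')) = fun g => ℙ (Prod.mk g ⁻¹'
        {q : G × (X × G) | itinerary s (rightTranslation q.1 q.2) ∈ A' ∧
          itinerary s q.2 ∈ B'}) := by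
      funext g
      rw [Measure.map_apply hπ ((hVm g hA').inter hB')]
      refine measure_congr ?_
      filter_upwards [hV g] with z hz
      simp only [Function.comp_apply] at hz
      simp only [eq_iff_iff]
      change V g (itinerary s z) ∈ A' ∧ _ ↔ _ ∧ _
      rw [← hz]
    rw [hset]
    refine measurable_measure_prodMk_left ?_
    have h1 : Measurable fun q : G × (X × G) => rightTranslation q.1 q.2 := by
      unfold rightTranslation
      fun_prop
    exact ((hπ.comp h1) hA').inter ((hπ.comp measurable_snd) hB')
  · rw [MeasurableSpace.comp_eq_of_measurable_invariants hπinv]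
  · exact fun A' hA' => ⟨_, hπinv hA', EventuallyEq.rfl⟩

end Existence

/-! ### Jointly measurable versions of actions -/

open ProbabilityTheory in
/-- A non-singular action on a standard probability space has a version which is measurable in both
variables. -/
theorem IsNonsingularAction.exists_measurable_version {G : Type u} [Group G] [MeasurableSpace G]
    {Y : Type v} [MeasurableSpace Y] [StandardBorelSpace Y] {ν : Measure Y}
    [IsProbabilityMeasure ν] {S : G → Y → Y} (hS : IsNonsingularAction ν S) :
    ∃ Φ : G × Y → Y, Measurable Φ ∧ ∀ g, (fun y => Φ (g, y)) =ᵐ[ν] S g := by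
  have hne : Nonempty Y := nonempty_of_isProbabilityMeasure ν
  have hm (g : G) : Measurable (S g) := (hS.quasiMeasurePreserving g).measurable
  have hm' (g : G) : Measurable fun y => (y, S g y) := measurable_id.prodMk (hm g)
  have hprob (g : G) : IsProbabilityMeasure (ν.map fun y => (y, S g y)) :=
    Measure.isProbabilityMeasure_map (hm' g).aemeasurable
  -- The graph measures of the maps `S g`. Disintegrating them over the first coordinate, measurably
  -- in `g`, gives Dirac masses at `S g y` for almost every `y`.
  let κ : Kernel G (Y × Y) :=
    { toFun := fun g => ν.map fun y => (y, S g y)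
      measurable' := by
        refine Measurable.measure_of_isPiSystem_of_isProbabilityMeasure
          generateFrom_prod.symm isPiSystem_prod ?_
        rintro _ ⟨B, hB, A, hA, rfl⟩
        simp_rw [Measure.map_apply (hm' _) (MeasurableSet.prod hB hA)]
        convert! hS.measurable_action A B hA hB using 3
        ext y
        simp [and_comm] }
  have hκ (g : G) : κ g = ν.map fun y => (y, S g y) := rfl
  have : IsMarkovKernel κ := ⟨hprob⟩
  -- A Dirac mass is turned back into its point by integrating a real embedding.
  let Ψ : G × Y → ℝ := fun q => ∫ y, embeddingReal Y y ∂(κ.condKernel q)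
  have hΨ : Measurable Ψ :=
    ((measurable_embeddingReal Y).stronglyMeasurable.integral_kernel).measurable
  have he := measurableEmbedding_embeddingReal Y
  refine ⟨fun q => he.invFun (Ψ q), he.measurable_invFun.comp hΨ, fun g => ?_⟩
  have hfst : κ.fst g = ν := by
    rw [Kernel.fst_apply, hκ, Measure.map_map measurable_fst (hm' g)]
    exact Measure.map_id
  have h₁ := κ.condKernel_apply_eq_condKernel g
  have h₂ := condKernel_compProd ν (Kernel.deterministic (S g) (hm g))
  simp only [Measure.compProd_deterministic, ← hκ] at h₂
  rw [hfst] at h₁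
  filter_upwards [h₁, h₂] with y h₁ h₂
  simp only [Ψ, h₁, h₂, Kernel.deterministic_apply, integral_dirac]
  exact he.leftInverse_invFun _

/-! ### The product measure on `G^ℕ` and the shift -/

section Bernoulli

variable {G : Type u} [MeasurableSpace G] (p : Measure G) [IsProbabilityMeasure p]

theorem measurable_shift : Measurable (shift : (ℕ → G) → ℕ → G) :=
  measurable_pi_iff.2 fun n => measurable_pi_apply (n + 1)

theorem measurable_firstJump : Measurable (firstJump : (ℕ → G) → G) :=
  measurable_pi_apply 0

/-- A finite box in `G^ℕ` can be written as a condition on an initial segment of coordinates. -/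
theorem exists_pi_range_eq {G : Type u} (s : Finset ℕ) (t : ℕ → Set G) :
    ∃ n, s ⊆ Finset.range n ∧
      (s : Set ℕ).pi t = {x | ∀ i < n, x i ∈ if i ∈ s then t i else univ} := by
  obtain ⟨n, hn⟩ := s.exists_nat_subset_range
  refine ⟨n, hn, ?_⟩
  ext x
  simp only [Set.mem_pi, Finset.mem_coe, mem_ofPred_eq]
  refine ⟨fun h i _ => ?_, fun h i hi => ?_⟩
  · split_ifs with his
    exacts [h i his, mem_univ _]
  · simpa [hi] using h i (Finset.mem_range.1 (hn hi))

theorem infinitePi_forall_lt (n : ℕ) {t : ℕ → Set G} (ht : ∀ i, MeasurableSet (t i)) :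
    Measure.infinitePi (fun _ : ℕ => p) {x | ∀ i < n, x i ∈ t i} =
      ∏ i ∈ Finset.range n, p (t i) := by
  rw [← Measure.infinitePi_pi (fun _ : ℕ => p) (fun i _ => ht i)]
  congr 1
  ext x
  simp

/-- The first coordinate and the shift split the product measure on `G^ℕ` as a product. -/
theorem measurePreserving_firstJump_shift :
    MeasurePreserving (fun x : ℕ → G => (firstJump x, shift x))
      (Measure.infinitePi fun _ : ℕ => p) (p.prod (Measure.infinitePi fun _ : ℕ => p)) := by
  -- A right inverse of the splitting, so that the measures can be compared on boxes of `G^ℕ`.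
  let cons : G × (ℕ → G) → ℕ → G := fun q n => Nat.casesOn n q.1 q.2
  have hcons : Measurable cons := by
    refine measurable_pi_iff.2 fun n => ?_
    cases n with
    | zero => exact measurable_fst
    | succ n => exact (measurable_pi_apply n).comp measurable_snd
  have hmap : (p.prod (Measure.infinitePi fun _ : ℕ => p)).map cons =
      Measure.infinitePi fun _ : ℕ => p := by
    refine Measure.eq_infinitePi _ fun s t ht => ?_
    have ht' (i : ℕ) : MeasurableSet (if i ∈ s then t i else univ) := by
      split_ifs
      exacts [ht i, MeasurableSet.univ]
    rw [Measure.map_apply hcons (MeasurableSet.pi s.countable_toSet fun i _ => ht i)]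
    obtain ⟨n, hn, hs⟩ := exists_pi_range_eq s t
    have hn' : s ⊆ Finset.range (n + 1) := hn.trans (by simp)
    have hset : cons ⁻¹' (s : Set ℕ).pi t = (if 0 ∈ s then t 0 else univ) ×ˢ
        {x : ℕ → G | ∀ i < n, x i ∈ if i + 1 ∈ s then t (i + 1) else univ} := by
      ext q
      simp only [mem_preimage, Set.mem_pi, Finset.mem_coe, mem_prod, mem_ofPred_eq]
      constructor
      · intro h
        refine ⟨?_, fun i _ => ?_⟩
        · split_ifs with h0
          exacts [h 0 h0, mem_univ _]
        · split_ifs with h1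
          exacts [h (i + 1) h1, mem_univ _]
      · rintro ⟨h0, h1⟩ i hi
        cases i with
        | zero => exact show q.1 ∈ t 0 by simpa [hi] using h0
        | succ i => simpa [hi] using h1 i (by have := Finset.mem_range.1 (hn' hi); omega)
    rw [hset, Measure.prod_prod,
      infinitePi_forall_lt p n (t := fun i => if i + 1 ∈ s then t (i + 1) else univ)
        fun i => ht' (i + 1), mul_comm,
      ← Finset.prod_range_succ' (fun i => p (if i ∈ s then t i else univ)) n]
    rw [← Finset.prod_subset hn' (fun i _ hi => by simp [hi])]
    exact Finset.prod_congr rfl fun i hi => by simp [hi]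
  refine ⟨measurable_firstJump.prodMk measurable_shift, ?_⟩
  rw [← hmap, Measure.map_map (measurable_firstJump.prodMk measurable_shift) hcons]
  rw [hmap]
  exact Measure.map_id

theorem measurePreserving_shift :
    MeasurePreserving shift (Measure.infinitePi fun _ : ℕ => p)
      (Measure.infinitePi fun _ : ℕ => p) :=
  measurePreserving_snd.comp (measurePreserving_firstJump_shift p)

end Bernoulli

/-! ### The random ergodic theorem -/

section RandomErgodic

variable {G : Type u} [MeasurableSpace G] {Y : Type v} [MeasurableSpace Y] {p : Measure G}
  [IsProbabilityMeasure p] {ν : Measure Y} [IsProbabilityMeasure ν] {Φ : G × Y → Y}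
  {C : Set ((ℕ → G) × Y)}

/-- Conditioning on the first coordinate, for a set which is invariant under the random
transformation. -/
theorem ae_measure_slice_inter_eq (hΦ : Measurable Φ) (hC : MeasurableSet C)
    (hinv : ∀ᵐ q ∂(Measure.infinitePi fun _ : ℕ => p).prod ν,
      (q ∈ C ↔ (shift q.1, Φ (firstJump q.1, q.2)) ∈ C))
    {A : Set G} (hA : MeasurableSet A) {E : Set (ℕ → G)} (hE : MeasurableSet E) :
    ∀ᵐ y ∂ν, Measure.infinitePi (fun _ : ℕ => p)
        ({x | (x, y) ∈ C} ∩ {x | firstJump x ∈ A ∧ shift x ∈ E}) =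
      ∫⁻ g in A, Measure.infinitePi (fun _ : ℕ => p) ({x | (x, Φ (g, y)) ∈ C} ∩ E) ∂p := by
  have hR : Measurable fun q : (ℕ → G) × Y => (shift q.1, Φ (firstJump q.1, q.2)) :=
    (measurable_shift.comp measurable_fst).prodMk
      (hΦ.comp ((measurable_firstJump.comp measurable_fst).prodMk measurable_snd))
  have hsw := (Measure.ae_ae_comm (μ := Measure.infinitePi fun _ : ℕ => p) (ν := ν)
    (p := fun x y => ((x, y) ∈ C ↔ (shift x, Φ (firstJump x, y)) ∈ C))
    (MeasurableSet.iff hC (hR hC))).1 (Measure.ae_ae_of_ae_prod hinv)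
  filter_upwards [hsw] with y hy
  have hD : MeasurableSet {q : G × (ℕ → G) | (q.2, Φ (q.1, y)) ∈ C} :=
    (measurable_snd.prodMk (hΦ.comp (measurable_fst.prodMk measurable_const))) hC
  have hD' : MeasurableSet ({q : G × (ℕ → G) | (q.2, Φ (q.1, y)) ∈ C} ∩ (A ×ˢ E)) :=
    hD.inter (hA.prod hE)
  have h1 : Measure.infinitePi (fun _ : ℕ => p)
        ({x | (x, y) ∈ C} ∩ {x | firstJump x ∈ A ∧ shift x ∈ E}) =
      p.prod (Measure.infinitePi fun _ : ℕ => p)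
        ({q : G × (ℕ → G) | (q.2, Φ (q.1, y)) ∈ C} ∩ (A ×ˢ E)) := by
    rw [← (measurePreserving_firstJump_shift p).measure_preimage hD'.nullMeasurableSet]
    refine measure_congr ?_
    filter_upwards [hy] with x hx
    exact propext (and_congr_left' hx)
  rw [h1, Measure.prod_apply hD', ← lintegral_indicator hA]
  refine lintegral_congr fun g => ?_
  by_cases hg : g ∈ A
  · rw [indicator_of_mem hg]
    congr 1
    ext x
    simp [hg]
  · rw [indicator_of_notMem hg]
    have : Prod.mk g ⁻¹' ({q : G × (ℕ → G) | (q.2, Φ (q.1, y)) ∈ C} ∩ (A ×ˢ E)) = ∅ := by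
      ext x
      simp [hg]
    rw [this, measure_empty]

end RandomErgodic

section RandomErgodicTheorem

/-- A bounded function which is an average of its translates under measure preserving maps equals
almost all of them. -/
theorem ae_comp_eq_of_ae_eq_integral {G : Type u} [MeasurableSpace G] {Y : Type v}
    [MeasurableSpace Y] {p : Measure G} [IsProbabilityMeasure p] {ν : Measure Y}
    [IsProbabilityMeasure ν] {Φ : G × Y → Y} (hΦ : Measurable Φ)
    (hpres : ∀ g, MeasurePreserving (fun y => Φ (g, y)) ν ν) {k : Y → ℝ} (hk : Measurable k)
    {b : ℝ} (hb : ∀ y, |k y| ≤ b) (hmean : ∀ᵐ y ∂ν, k y = ∫ g, k (Φ (g, y)) ∂p) :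
    ∀ᵐ g ∂p, (fun y => k (Φ (g, y))) =ᵐ[ν] k := by
  have hb2 (y y' : Y) : ‖k y * k y'‖ ≤ b * b := by
    rw [norm_mul]
    exact mul_le_mul (hb y) (hb y') (norm_nonneg _) ((abs_nonneg _).trans (hb y))
  have hu : Measurable fun q : G × Y => k (Φ q) := hk.comp hΦ
  have hv : Measurable fun q : G × Y => k q.2 := hk.comp measurable_snd
  have hiuu : Integrable (fun q : G × Y => k (Φ q) * k (Φ q)) (p.prod ν) :=
    .of_bound (hu.mul hu).aestronglyMeasurable (b * b) (.of_forall fun q => hb2 _ _)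
  have hivv : Integrable (fun q : G × Y => k q.2 * k q.2) (p.prod ν) :=
    .of_bound (hv.mul hv).aestronglyMeasurable (b * b) (.of_forall fun q => hb2 _ _)
  have hiuv : Integrable (fun q : G × Y => k q.2 * k (Φ q)) (p.prod ν) :=
    .of_bound (hv.mul hu).aestronglyMeasurable (b * b) (.of_forall fun q => hb2 _ _)
  have huu : ∫ q, k (Φ q) * k (Φ q) ∂(p.prod ν) = ∫ y, k y * k y ∂ν := by
    rw [integral_prod _ hiuu]
    have (g : G) : ∫ y, k (Φ (g, y)) * k (Φ (g, y)) ∂ν = ∫ y, k y * k y ∂ν := by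
      conv_rhs => rw [← (hpres g).map_eq]
      exact (integral_map (hpres g).measurable.aemeasurable
        (f := fun y => k y * k y) (hk.mul hk).aestronglyMeasurable).symm
    simp [this]
  have hvv : ∫ q : G × Y, k q.2 * k q.2 ∂(p.prod ν) = ∫ y, k y * k y ∂ν := by
    rw [integral_prod _ hivv]
    simp
  have huv : ∫ q : G × Y, k q.2 * k (Φ q) ∂(p.prod ν) = ∫ y, k y * k y ∂ν := by
    rw [integral_prod_symm _ hiuv]
    refine integral_congr_ae ?_
    filter_upwards [hmean] with y hy
    simp only [integral_const_mul]
    rw [← hy]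
  -- Expanding the square, all three integrals equal `∫ k²`: one by invariance of `ν`, the cross
  -- term by the mean value property.
  have hsq : ∫ q : G × Y, (k (Φ q) - k q.2) ^ 2 ∂(p.prod ν) = 0 := by
    have : (fun q : G × Y => (k (Φ q) - k q.2) ^ 2) = fun q =>
        k (Φ q) * k (Φ q) + k q.2 * k q.2 - 2 * (k q.2 * k (Φ q)) := by
      funext q
      ring
    rw [this]
    refine (integral_sub (hiuu.add hivv) (hiuv.const_mul 2)).trans ?_
    rw [integral_add' hiuu hivv, integral_const_mul, huu, hvv, huv]
    ring
  have hisq : Integrable (fun q : G × Y => (k (Φ q) - k q.2) ^ 2) (p.prod ν) := by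
    refine ((hiuu.add hivv).sub (hiuv.const_mul 2)).congr (.of_forall fun q => ?_)
    simp only [Pi.add_apply, Pi.sub_apply]
    ring
  have h0 := (integral_eq_zero_iff_of_nonneg (fun q => sq_nonneg _) hisq).1 hsq
  filter_upwards [Measure.ae_ae_of_ae_prod h0] with g hg
  filter_upwards [hg] with y hy
  exact sub_eq_zero.1 (pow_eq_zero_iff two_ne_zero |>.1 hy)

variable {G : Type u} [Group G] [TopologicalSpace G] [IsTopologicalGroup G]
  [LocallyCompactSpace G] [PolishSpace G] [MeasurableSpace G] [BorelSpace G]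
  {Y : Type v} [MeasurableSpace Y] [StandardBorelSpace Y] {p : Measure G}
  [IsProbabilityMeasure p] {ν : Measure Y} {S : G → Y → Y} {Φ : G × Y → Y}
  {C : Set ((ℕ → G) × Y)}

/-- The random ergodic theorem: if the walk is adapted and the probability preserving action is
ergodic, then the random transformation `(x, y) ↦ (shift x, S (x 0) y)` is ergodic. -/
theorem IsProbabilityPreservingAction.random_ergodic
    (hS : IsProbabilityPreservingAction ν S) (hE : IsErgodicAction ν S) (hp : IsAdaptedWalk p)
    (hΦ : Measurable Φ) (hΦS : ∀ g, (fun y => Φ (g, y)) =ᵐ[ν] S g) (hC : MeasurableSet C)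
    (hinv : ∀ᵐ q ∂(Measure.infinitePi fun _ : ℕ => p).prod ν,
      (q ∈ C ↔ (shift q.1, Φ (firstJump q.1, q.2)) ∈ C)) :
    (Measure.infinitePi fun _ : ℕ => p).prod ν C = 0 ∨
      (Measure.infinitePi fun _ : ℕ => p).prod ν Cᶜ = 0 := by
  have := hS.isProbabilityMeasure
  set m : Measure (ℕ → G) := Measure.infinitePi fun _ : ℕ => p with hm
  have hΦg (g : G) : Measurable fun y => Φ (g, y) := hΦ.comp measurable_prodMk_left
  have hpres (g : G) : MeasurePreserving (fun y => Φ (g, y)) ν ν :=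
    ⟨hΦg g, (Measure.map_congr (hΦS g)).trans (hS.measurePreserving g).map_eq⟩
  have hCy (y : Y) : MeasurableSet {x | (x, y) ∈ C} := measurable_prodMk_right hC
  have hN {E : Set (ℕ → G)} (hE : MeasurableSet E) :
      Measurable fun y => m ({x | (x, y) ∈ C} ∩ E) :=
    measurable_measure_prodMk_right (hC.inter (measurable_fst hE))
  have hN0 : Measurable fun y => m {x | (x, y) ∈ C} := measurable_measure_prodMk_right hC
  -- The slices of `C` have constant measure.
  obtain ⟨c, hc⟩ : ∃ c : ℝ≥0∞, ∀ᵐ y ∂ν, m {x | (x, y) ∈ C} = c := by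
    have hk : Measurable fun y => m.real {x | (x, y) ∈ C} := hN0.ennreal_toReal
    have hmean : ∀ᵐ y ∂ν, m.real {x | (x, y) ∈ C} = ∫ g, m.real {x | (x, Φ (g, y)) ∈ C} ∂p := by
      filter_upwards [ae_measure_slice_inter_eq hΦ hC hinv MeasurableSet.univ
        MeasurableSet.univ] with y hy
      simp only [mem_univ, and_self, ofPred_true, inter_univ, Measure.restrict_univ] at hy
      rw [measureReal_def, hy]
      refine (integral_toReal ?_ (.of_forall fun g => measure_lt_top _ _)).symm
      exact (hN0.comp (hΦ.comp measurable_prodMk_right)).aemeasurable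
    have hae := ae_comp_eq_of_ae_eq_integral hΦ hpres hk (b := 1)
      (fun y => by rw [abs_of_nonneg measureReal_nonneg]; exact measureReal_le_one) hmean
    obtain ⟨c, hc⟩ := hS.exists_ae_eq_const hE hp hk (by
      filter_upwards [hae] with g hg
      exact ((hΦS g).fun_comp _).symm.trans hg)
    refine ⟨ENNReal.ofReal c, ?_⟩
    filter_upwards [hc] with y hy
    rw [← ofReal_measureReal (μ := m), hy]
    rfl
  -- Hence they are independent of every box, and then of every measurable set.
  have hqmp : Measure.QuasiMeasurePreserving Φ (p.prod ν) ν :=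
    QuasiMeasurePreserving.prod_of_right hΦ (.of_forall fun g => (hpres g).quasiMeasurePreserving)
  have hbox (n : ℕ) : ∀ t : ℕ → Set G, (∀ i, MeasurableSet (t i)) →
      ∀ᵐ y ∂ν, m ({x | (x, y) ∈ C} ∩ {x | ∀ i < n, x i ∈ t i}) =
        c * m {x | ∀ i < n, x i ∈ t i} := by
    induction n with
    | zero =>
      intro t _
      simpa using hc
    | succ n ih =>
      intro t ht
      have hEm : MeasurableSet {x : ℕ → G | ∀ i < n, x i ∈ t (i + 1)} := by
        simp only [ofPred_forall]
        exact .iInter fun i => .iInter fun _ => measurable_pi_apply i (ht _)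
      have hset : {x : ℕ → G | ∀ i < n + 1, x i ∈ t i} =
          {x | firstJump x ∈ t 0 ∧ shift x ∈ {x : ℕ → G | ∀ i < n, x i ∈ t (i + 1)}} := by
        ext x
        exact Nat.forall_lt_succ_left
      have hswap : ∀ᵐ y ∂ν, ∀ᵐ g ∂p,
          m ({x | (x, Φ (g, y)) ∈ C} ∩ {x | ∀ i < n, x i ∈ t (i + 1)}) =
            c * m {x | ∀ i < n, x i ∈ t (i + 1)} := by
        refine (Measure.ae_ae_comm ?_).1 (Measure.ae_ae_of_ae_prod
          (hqmp.ae (ih (fun i => t (i + 1)) fun i => ht (i + 1))))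
        exact measurableSet_eq_fun ((hN hEm).comp hΦ) measurable_const
      filter_upwards [ae_measure_slice_inter_eq hΦ hC hinv (ht 0) hEm, hswap] with y h₁ h₂
      rw [hset]
      refine h₁.trans ?_
      rw [lintegral_congr_ae (ae_restrict_of_ae h₂), lintegral_const,
        Measure.restrict_apply_univ]
      have : m {x | firstJump x ∈ t 0 ∧ shift x ∈ {x : ℕ → G | ∀ i < n, x i ∈ t (i + 1)}} =
          p (t 0) * m {x : ℕ → G | ∀ i < n, x i ∈ t (i + 1)} := by
        rw [← Measure.prod_prod, ← (measurePreserving_firstJump_shift p).measure_preimage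
          ((ht 0).prod hEm).nullMeasurableSet]
        rfl
      rw [this]
      ring
  have hindep {E : Set (ℕ → G)} (hE : MeasurableSet E) :
      ∀ᵐ y ∂ν, m ({x | (x, y) ∈ C} ∩ E) = c * m E := by
    refine MeasurableSpace.induction_on_inter
      (C := fun E _ => ∀ᵐ y ∂ν, m ({x | (x, y) ∈ C} ∩ E) = c * m E)
      generateFrom_squareCylinders.symm
      (isPiSystem_squareCylinders (fun _ => MeasurableSpace.isPiSystem_measurableSet)
        fun _ => MeasurableSet.univ) ?_ ?_ ?_ ?_ E hE
    · simp
    · rintro _ ⟨s, t, ht, rfl⟩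
      obtain ⟨n, -, hs⟩ := exists_pi_range_eq s t
      rw [hs]
      refine hbox n _ fun i => ?_
      split_ifs
      exacts [ht i (mem_univ i), MeasurableSet.univ]
    · intro E hE ih
      filter_upwards [ih, hc] with y h₁ h₂
      have hd : {x | (x, y) ∈ C} ∩ Eᶜ = {x | (x, y) ∈ C} \ ({x | (x, y) ∈ C} ∩ E) := by
        ext x
        simp only [mem_inter_iff, mem_compl_iff, Set.mem_sdiff]
        tauto
      rw [hd, measure_sdiff inter_subset_left ((hCy y).inter hE).nullMeasurableSet
        (measure_ne_top _ _), h₁, h₂, measure_compl hE (measure_ne_top _ _), measure_univ,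
        ENNReal.mul_sub (fun _ _ => h₂ ▸ measure_ne_top _ _), mul_one]
    · intro E hd hE ih
      filter_upwards [ae_all_iff.2 ih] with y hy
      rw [inter_iUnion, measure_iUnion
        (fun i j hij => (hd hij).mono inter_subset_right inter_subset_right)
        (fun i => (hCy y).inter (hE i)), measure_iUnion hd hE, ← ENNReal.tsum_mul_left]
      exact tsum_congr hy
  -- Independence identifies `c (m × ν)` with the restriction of `m × ν` to `C`; evaluating at `Cᶜ`
  -- gives `c = 0` or `Cᶜ` null.
  have hprod : (c • m).prod ν = (m.prod ν).restrict C := by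
    have hcf : IsFiniteMeasure (c • m) := by
      obtain ⟨y, hy⟩ := hc.exists
      rw [← hy]
      exact Measure.smul_finite m (measure_ne_top _ _)
    refine Measure.prod_eq fun E F hE hF => ?_
    rw [Measure.restrict_apply (hE.prod hF), Measure.prod_apply_symm ((hE.prod hF).inter hC)]
    have : ∀ᵐ y ∂ν, m ((fun x => (x, y)) ⁻¹' (E ×ˢ F ∩ C)) =
        F.indicator (fun _ => c * m E) y := by
      filter_upwards [hindep hE] with y hy
      by_cases hyF : y ∈ F
      · rw [indicator_of_mem hyF, ← hy]
        congr 1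
        ext x
        simp [hyF, and_comm]
      · rw [indicator_of_notMem hyF]
        have : (fun x => (x, y)) ⁻¹' (E ×ˢ F ∩ C) = ∅ := by
          ext x
          simp [hyF]
        rw [this, measure_empty]
    rw [lintegral_congr_ae this, lintegral_indicator_const hF]
    rfl
  rw [Measure.prod_smul_left] at hprod
  have h0 := congrArg (fun μ : Measure ((ℕ → G) × Y) => μ Cᶜ) hprod
  simp only [Measure.smul_apply, smul_eq_mul, Measure.restrict_apply hC.compl, compl_inter_self,
    measure_empty, mul_eq_zero] at h0
  refine h0.imp (fun hc0 => ?_) id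
  rw [Measure.prod_apply_symm hC]
  refine (lintegral_eq_zero_iff hN0).2 ?_
  filter_upwards [hc] with y hy
  exact hy.trans hc0

end RandomErgodicTheorem

/-! ### Weak mixing of the Poisson boundary -/

variable {G : Type u} [Group G] [TopologicalSpace G] [IsTopologicalGroup G]
  [LocallyCompactSpace G] [PolishSpace G] [MeasurableSpace G] [BorelSpace G]

/-- A measurable subset of `G × W` which is invariant modulo null sets under right translations of
the first coordinate only depends on the second coordinate, modulo null sets. -/
theorem exists_ae_mem_iff_snd_mem {W : Type w} [MeasurableSpace W] {κ : Measure W} [SFinite κ]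
    {B : Set (G × W)} (hB : MeasurableSet B)
    (h : ∀ t : G, ∀ᵐ q ∂(Measure.haar : Measure G).prod κ, (q ∈ B ↔ (q.1 * t⁻¹, q.2) ∈ B)) :
    ∃ C : Set W, MeasurableSet C ∧
      ∀ᵐ q ∂(Measure.haar : Measure G).prod κ, (q ∈ B ↔ q.2 ∈ C) := by
  have h₁ := (Measure.ae_ae_comm (μ := (Measure.haar : Measure G))
    (ν := (Measure.haar : Measure G).prod κ)
    (p := fun t q => (q ∈ B ↔ (q.1 * t⁻¹, q.2) ∈ B))
    ((measurable_snd hB).iff (hB.preimage (by fun_prop)))).1 (.of_forall h)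
  obtain ⟨g₀, hg₀⟩ := (Measure.ae_ae_of_ae_prod h₁).exists
  have hC : MeasurableSet (Prod.mk g₀ ⁻¹' B) := measurable_prodMk_left hB
  refine ⟨Prod.mk g₀ ⁻¹' B, hC, ?_⟩
  -- The solution `t = g⁻¹ * g₀` of `g₀ * t⁻¹ = g` is a nonsingular function of `g`, so "almost
  -- every `t`" becomes "almost every `g`".
  have hq : Measure.QuasiMeasurePreserving (fun g : G => g⁻¹ * g₀) Measure.haar Measure.haar :=
    (quasiMeasurePreserving_mul_right Measure.haar g₀).comp
      (quasiMeasurePreserving_inv Measure.haar)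
  have h₂ : ∀ᵐ w ∂κ, ∀ᵐ g ∂(Measure.haar : Measure G), ((g, w) ∈ B ↔ w ∈ Prod.mk g₀ ⁻¹' B) := by
    filter_upwards [hg₀] with w hw
    filter_upwards [hq.ae hw] with g hg
    simpa using hg.symm
  have hm : MeasurableSet {q : G × W | q ∈ B ↔ q.2 ∈ Prod.mk g₀ ⁻¹' B} :=
    MeasurableSet.iff hB (measurable_snd hC)
  rw [Measure.ae_prod_iff_ae_ae hm]
  exact (Measure.ae_ae_comm (p := fun w g => ((g, w) ∈ B ↔ w ∈ Prod.mk g₀ ⁻¹' B))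
    (hm.preimage measurable_swap)).1 h₂

variable {Y : Type v} [MeasurableSpace Y] {p : Measure G} [IsProbabilityMeasure p]
  {ν : Measure Y}

/-- The skew product over the jump process driven by measure preserving maps of `Y` and by left
translations of `G` preserves the product measure. -/
theorem measurePreserving_randomWalk_prod [SFinite ν] {Φ : G × Y → Y} (hΦ : Measurable Φ)
    (hpres : ∀ g, MeasurePreserving (fun y => Φ (g, y)) ν ν) :
    MeasurePreserving (fun q : G × ((ℕ → G) × Y) =>
        (firstJump q.2.1 * q.1, (shift q.2.1, Φ (firstJump q.2.1, q.2.2))))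
      ((Measure.haar : Measure G).prod ((Measure.infinitePi fun _ : ℕ => p).prod ν))
      ((Measure.haar : Measure G).prod ((Measure.infinitePi fun _ : ℕ => p).prod ν)) := by
  have hj : Measurable (firstJump : (ℕ → G) → G) := measurable_firstJump
  have h₁ := (measurePreserving_shift p).skew_product (μc := ν) (μd := ν)
    (g := fun x y => Φ (firstJump x, y))
    (hΦ.comp ((hj.comp measurable_fst).prodMk measurable_snd))
    (.of_forall fun x => (hpres _).map_eq)
  have h₂ := h₁.skew_product (μc := (Measure.haar : Measure G)) (μd := (Measure.haar : Measure G))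
    (g := fun w g => firstJump w.1 * g)
    (((hj.comp (measurable_fst.comp measurable_fst))).mul measurable_snd)
    (.of_forall fun w => map_mul_left_eq_self _ _)
  exact Measure.measurePreserving_swap.comp (h₂.comp Measure.measurePreserving_swap)

/-- The Poisson boundary of an adapted random walk is weakly mixing. -/
theorem IsPoissonBoundary.isWeaklyMixing (hp : IsAdaptedWalk p) {Ω : Type w} [MeasurableSpace Ω]
    {P : Measure Ω} {V : G → Ω → Ω} (h : IsPoissonBoundary p P V) :
    IsWeaklyMixing.{u, w, v} P V := by
  intro Y _ _ ν S hS hE A hA hinv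
  obtain ⟨-, ℙ, π, hprob, hℙ₁, hℙ₂, hπ, hπT, -, -, hπQ⟩ := h
  have hν := hS.isProbabilityMeasure
  have hP : IsProbabilityMeasure P :=
    hπ.map_eq ▸ Measure.isProbabilityMeasure_map hπ.measurable.aemeasurable
  obtain ⟨Φ, hΦ, hΦS⟩ := hS.exists_measurable_version
  set m : Measure (ℕ → G) := Measure.infinitePi fun _ : ℕ => p with hm
  let mG : Measure G := Measure.haar
  have hpres (g : G) : MeasurePreserving (fun y => Φ (g, y)) ν ν :=
    ⟨hΦ.comp measurable_prodMk_left,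
      (Measure.map_congr (hΦS g)).trans (hS.measurePreserving g).map_eq⟩
  have hΦmul (a b : G) : ∀ᵐ y ∂ν, Φ (a, Φ (b, y)) = Φ (a * b, y) := by
    filter_upwards [(hpres b).quasiMeasurePreserving.ae (hΦS a), hΦS b, hΦS (a * b),
      hS.mul_ae a b] with y h₁ h₂ h₃ h₄
    rw [h₁, h₂, h₃, h₄, Function.comp_apply]
  have hΦone : ∀ᵐ y ∂ν, Φ (1, y) = y := by
    filter_upwards [hΦS 1, hS.one_ae] with y h₁ h₂
    exact h₁.trans h₂
  -- The lift of `A`, and its change of coordinates.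
  let A' : Set (((ℕ → G) × G) × Y) := {q | (π q.1, q.2) ∈ A}
  have hA' : MeasurableSet A' := hA.preimage (by have := hπ.measurable; fun_prop)
  let B : Set (((ℕ → G) × G) × Y) := {q | (q.1, Φ (q.1.2⁻¹, q.2)) ∈ A'}
  have hB : MeasurableSet B := hA'.preimage (by fun_prop)
  -- The twist absorbs `S_t`, because `t * g⁻¹ = (g * t⁻¹)⁻¹`.
  have hQ (t : G) : ∀ᵐ z ∂m.prod mG, ∀ᵐ y ∂ν, ((z, y) ∈ B ↔ (rightTranslation t z, y) ∈ B) := by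
    have h₁ := hℙ₂.ae_le (hπ.quasiMeasurePreserving.ae (Measure.ae_ae_of_ae_prod (hinv t)))
    filter_upwards [h₁, hℙ₂.ae_le (hπQ t)] with z hz hzQ
    filter_upwards [(hpres z.2⁻¹).quasiMeasurePreserving.ae hz,
      (hpres z.2⁻¹).quasiMeasurePreserving.ae (hΦS t), hΦmul t z.2⁻¹] with y hy₁ hy₂ hy₃
    change (π z, _) ∈ A ↔ (π (rightTranslation t z), Φ ((z.2 * t⁻¹)⁻¹, y)) ∈ A
    rw [mul_inv_rev, inv_inv, ← hy₃, hy₂, show π (rightTranslation t z) = V t (π z) from hzQ]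
    exact (iff_of_eq hy₁).symm
  -- The twist makes `x₁` act on `Y`, because `(x₁ * g)⁻¹ * x₁ = g⁻¹`.
  have hT : ∀ᵐ z ∂m.prod mG, ∀ᵐ y ∂ν,
      ((z, y) ∈ B ↔ (skewProduct shift firstJump z, Φ (firstJump z.1, y)) ∈ B) := by
    filter_upwards [hℙ₂.ae_le hπT] with z hz
    filter_upwards [hΦmul (firstJump z.1 * z.2)⁻¹ (firstJump z.1)] with y hy
    change (π z, Φ (z.2⁻¹, y)) ∈ A ↔ (π (skewProduct shift firstJump z),
      Φ ((firstJump z.1 * z.2)⁻¹, Φ (firstJump z.1, y))) ∈ A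
    rw [hy, show π (skewProduct shift firstJump z) = π z from hz, mul_inv_rev,
      inv_mul_cancel_right]
  let e : G × ((ℕ → G) × Y) → ((ℕ → G) × G) × Y := fun q => ((q.2.1, q.1), q.2.2)
  have he : MeasurePreserving e (mG.prod (m.prod ν)) ((m.prod mG).prod ν) :=
    (Measure.measurePreserving_swap.prod (MeasurePreserving.id ν)).comp
      (measurePreserving_prodAssoc mG m ν).symm
  have hsh : Measurable (shift : (ℕ → G) → ℕ → G) := measurable_shift
  have hj : Measurable (firstJump : (ℕ → G) → G) := measurable_firstJump
  obtain ⟨C, hC, hBC⟩ := exists_ae_mem_iff_snd_mem (κ := m.prod ν) (he.measurable hB) fun t =>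
    he.quasiMeasurePreserving.ae ((Measure.ae_prod_iff_ae_ae
      (p := fun q => (q ∈ B ↔ (rightTranslation t q.1, q.2) ∈ B))
      (hB.iff (hB.preimage (by unfold rightTranslation; fun_prop)))).2 (hQ t))
  have hTB := he.quasiMeasurePreserving.ae ((Measure.ae_prod_iff_ae_ae
    (p := fun q => (q ∈ B ↔ (skewProduct shift firstJump q.1, Φ (firstJump q.1.1, q.2)) ∈ B))
    (hB.iff (hB.preimage (by unfold skewProduct; fun_prop)))).2 hT)
  have hR := measurePreserving_randomWalk_prod (p := p) hΦ hpres
  have hCinv : ∀ᵐ q ∂m.prod ν, (q ∈ C ↔ (shift q.1, Φ (firstJump q.1, q.2)) ∈ C) := by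
    have : ∀ᵐ q ∂mG.prod (m.prod ν),
        (q.2 ∈ C ↔ (shift q.2.1, Φ (firstJump q.2.1, q.2.2)) ∈ C) := by
      filter_upwards [hBC, hTB, hR.quasiMeasurePreserving.ae hBC] with q h₁ h₂ h₃
      exact h₁.symm.trans (h₂.trans h₃)
    obtain ⟨g, hg⟩ := (Measure.ae_ae_of_ae_prod this).exists
    exact hg
  -- Taking `b` to be `False` or `True` transfers nullity or conullity from `C` to `A`.
  have key (b : Prop) (hb : ∀ᵐ q ∂m.prod ν, (q ∈ C ↔ b)) : ∀ᵐ r ∂P.prod ν, (r ∈ A ↔ b) := by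
    have h₁ : ∀ᵐ q ∂mG.prod (m.prod ν), (e q ∈ B ↔ b) := by
      filter_upwards [hBC, Measure.quasiMeasurePreserving_snd.ae hb] with q h₁ h₂
      exact h₁.trans h₂
    have h₂ : ∀ᵐ q ∂(m.prod mG).prod ν, (q ∈ B ↔ b) := by
      rw [← he.map_eq]
      exact (ae_map_iff he.measurable.aemeasurable (hB.iff (.const b))).2 h₁
    have h₃ : ∀ᵐ z ∂ℙ, ∀ᵐ y ∂ν, ((π z, y) ∈ A ↔ b) := by
      filter_upwards [hℙ₁.ae_le (Measure.ae_ae_of_ae_prod h₂)] with z hz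
      -- Evaluating at `Φ (g, y)` undoes the twist by `g⁻¹`.
      filter_upwards [(hpres z.2).quasiMeasurePreserving.ae hz, hΦmul z.2⁻¹ z.2, hΦone]
        with y hy₁ hy₂ hy₃
      rw [← hy₁]
      change _ ↔ (π z, Φ (z.2⁻¹, Φ (z.2, y))) ∈ A
      rw [hy₂, inv_mul_cancel, hy₃]
    have hπ' := hπ.prod (MeasurePreserving.id ν)
    rw [← hπ'.map_eq]
    refine (ae_map_iff hπ'.measurable.aemeasurable (hA.iff (.const b))).2 ?_
    exact (Measure.ae_prod_iff_ae_ae ((hπ'.measurable hA).iff (.const b))).2 h₃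
  rcases hS.random_ergodic hE hp hΦ hΦS hC hCinv with h0 | h0
  · left
    have := key False (by simpa [← measure_eq_zero_iff_ae_notMem] using h0)
    exact measure_eq_zero_iff_ae_notMem.2 (by simpa using this)
  · right
    have := key True (by simpa using mem_ae_iff.2 h0)
    exact mem_ae_iff.1 (by simpa using this)

end PoissonBdry

theorem proposition4p4 {G : Type u} [Group G] [TopologicalSpace G] [IsTopologicalGroup G]
    [LocallyCompactSpace G] [PolishSpace G] [MeasurableSpace G] [BorelSpace G]
    (p : Measure G) [IsProbabilityMeasure p] (hp : PoissonBdry.IsAdaptedWalk p) :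
    (∃ (Ω : Type) (_ : MeasurableSpace Ω) (_ : StandardBorelSpace Ω)
      (P : Measure Ω) (V : G → Ω → Ω), PoissonBdry.IsPoissonBoundary p P V) ∧
    ∀ (Ω : Type v) [MeasurableSpace Ω] [StandardBorelSpace Ω] (P : Measure Ω) (V : G → Ω → Ω),
      PoissonBdry.IsPoissonBoundary p P V → PoissonBdry.IsWeaklyMixing.{u, v, w} P V := by
  refine ⟨?_, fun Ω _ _ P V h => h.isWeaklyMixing hp⟩
  obtain ⟨P, V, h⟩ := PoissonBdry.exists_isPoissonAction
    (Measure.infinitePi fun _ : ℕ => p) PoissonBdry.shift PoissonBdry.firstJump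
  exact ⟨ℕ → Bool, inferInstance, inferInstance, P, V, h⟩
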